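/- Let $\lambda$ be a positive integer and let $(G,+)$ be an abelian group of order $2\lambda+1$. Let $(A,B)$ be a skew Hadamard difference family with two blocks in $G$, that is: $A,B\subset G$ are subsets of size $\lambda$ (possibly equal) such that $X\cap(-X)=\emptyset$ and $X\cup(-X)=G\setminus\{0\}$ for $X\in\{A,B\}$, and for every $g\in G\setminus\{0\}$ $$|\{(x,y)\in A\times A : g=x-y\}|+|\{(x,y)\in B\times B : g=x-y\}|=\lambda-1 .$$ Let $\mathcal{SZ}(G,A,B)$ be the Szekeres tournament, i.e. the directed graph with vertex set $V=\{v_0\}\cup\{a_g : g\in G\}\cup\{b_g : g\in G\}$ in which, for all $g\in G$: $v_0$ dominates exactly the vertices $a_x$ ($x\in G$); $a_g$ dominates exactly the vertices $a_{g+z}$ ($z\in A$) and $b_{g+z}$ ($z\in B\cup\{0\}$); and $b_g$ dominates exactly $v_0$, the vertices $b_{g+z}$ ($z\in -A$) and the vertices $a_{g+z}$ ($z\in B$). Let $\nu_Q:\mathbb{Z}^V\to\mathbb{Z}^V$ be the Laplacian map, which sends each vertex $v$ to $\Delta_v v-\sum_{w} w$, where the sum runs over the vertices $w$ dominated by $v$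 and $\Delta_v$ is their number; let $Q$ be its matrix in the basis $V$, and let the critical group $\mathcal{K}$ be the torsion subgroup of $\operatorname{coker}\nu_Q$. Then $$\mathcal{K}\cong(\mathbb{Z}/(\lambda+1)\mathbb{Z})^{2\lambda+1}\oplus(\mathbb{Z}/(4\lambda+3)\mathbb{Z})^{2\lambda}.$$ Moreover, for a prime $p$ let $\mathrm{rk}_p(Q)$ be the rank of $Q$ modulo $p$. If $p\mid\lambda+1$, then $\mathrm{rk}_p(Q)=2\lambda+1$; and if $p\mid 4\lambda+3$, then $\mathrm{rk}_p(Q)=2\lambda+2$. -/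

import Mathlib

open scoped Pointwise

section SkewDifferenceFamily

variable {G : Type*} [AddCommGroup G] [Fintype G] [DecidableEq G]

/-- A skew (Hadamard) difference family in the finite additive abelian group `G`, with parameters
`(n, k, m)`: a family of `k`-subsets of `G`, `|G| = n`, such that every nonzero element is
represented `m` times in all, over the blocks, as a difference of two elements of one block, and
such that each block `X` is disjoint from `-X` with `X ∪ -X = G \ {0}`. Equal blocks are
allowed; a difference occurring in several blocks is counted once for each of them. -/
structure IsSkewDifferenceFamily {ι : Type*} [Fintype ι] (B : ι → Finset G) (n k m : ℕ) :
    Prop where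
  card_group : Fintype.card G = n
  card_block : ∀ i, (B i).card = k
  card_differences : ∀ g : G, g ≠ 0 →
    ∑ i, ((B i ×ˢ B i).filter fun xy => g = xy.1 - xy.2).card = m
  disjoint_neg : ∀ i, Disjoint (B i) (-B i)
  union_neg : ∀ i, B i ∪ -B i = Finset.univ \ {0}

end SkewDifferenceFamily

noncomputable section DigraphLaplacian

namespace Digraph

variable {V : Type*} [Fintype V] (Γ : Digraph V)

open Classical in
/-- The set of vertices dominated by `v`. -/
def dominated (v : V) : Finset V := Finset.univ.filter fun w => Γ.Adj v w

/-- The adjacency map of the free abelian group on `V`: it sends `v` to the formal sum of the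
vertices dominated by `v`. -/
def adjacencyMap : (V →₀ ℤ) →ₗ[ℤ] (V →₀ ℤ) :=
  Finsupp.linearCombination ℤ fun v => ∑ w ∈ Γ.dominated v, Finsupp.single w (1 : ℤ)

/-- The Laplacian map: it sends `v` to `Δ_v v` minus the image of `v` under the adjacency map,
where `Δ_v` is the number of vertices dominated by `v`. -/
def laplacianMap : (V →₀ ℤ) →ₗ[ℤ] (V →₀ ℤ) :=
  (Finsupp.linearCombination ℤ fun v => ((Γ.dominated v).card : ℤ) • Finsupp.single v (1 : ℤ)) -
    Γ.adjacencyMap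

/-- The Laplacian matrix: the matrix of the Laplacian map in the basis `V`. -/
def laplacianMatrix [DecidableEq V] : Matrix V V ℤ :=
  LinearMap.toMatrix Finsupp.basisSingleOne Finsupp.basisSingleOne Γ.laplacianMap

/-- The critical group: the torsion subgroup (the finite part) of the cokernel of the Laplacian
map. -/
abbrev CriticalGroup : Type _ :=
  Submodule.torsion ℤ ((V →₀ ℤ) ⧸ LinearMap.range Γ.laplacianMap)

end Digraph

/-- The `p`-rank of an integer matrix: the rank of its reduction modulo `p`. -/
def Matrix.primeRank {V : Type*} [Fintype V] (p : ℕ) (Q : Matrix V V ℤ) : ℕ :=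
  (Q.map (Int.cast : ℤ → ZMod p)).rank

end DigraphLaplacian

section Szekeres

/-- Vertices of the Szekeres tournament: `none` is `v₀`, `some (Sum.inl g)` is `a_g` and
`some (Sum.inr g)` is `b_g`. -/
abbrev SzekeresVertex (G : Type*) : Type _ := Option (G ⊕ G)

/-- The Szekeres tournament: `v₀` dominates every `a_x`; `a_g` dominates `a_{g+z}` for `z ∈ A` and
`b_{g+z}` for `z ∈ B ∪ {0}`; `b_g` dominates `v₀`, `b_{g+z}` for `z ∈ -A` and `a_{g+z}` for
`z ∈ B`. -/
def szekeresTournament {G : Type*} [AddCommGroup G] [DecidableEq G] (A B : Finset G) :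
    Digraph (SzekeresVertex G) where
  Adj
    | none, none => False
    | none, some (Sum.inl _) => True
    | none, some (Sum.inr _) => False
    | some (Sum.inl _), none => False
    | some (Sum.inl g), some (Sum.inl h) => h - g ∈ A
    | some (Sum.inl g), some (Sum.inr h) => h - g ∈ B ∪ {0}
    | some (Sum.inr _), none => True
    | some (Sum.inr g), some (Sum.inl h) => h - g ∈ B
    | some (Sum.inr g), some (Sum.inr h) => h - g ∈ -A

end Szekeres

/-!
# The critical group of a Szekeres tournament

Put `n = 4 lam + 3` and let `D` be the Laplacian matrix, `J` the all-ones matrix. By the axioms of a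
skew difference family the tournament is doubly regular, that is
`D + Dᵀ = n - J`, `Dᵀ D = (lam + 1) (n - J)` and `J D = 0`
(`IsSkewPair.isDoublyRegularLaplacian`). Hence `D J = 0`, the matrices `D` and `Dᵀ` commute, and on
the lattice `L` of vectors of coordinate sum zero `Dᵀ = n - D` and `D Dᵀ = (lam + 1) n`. The critical
group `K` is the quotient of `L` by the range of `D`, so it is killed by the product of the coprime
numbers `lam + 1` and `n`, and splits as `K/(lam + 1)K × K/nK`.

The ranks of `D` modulo primes are found as follows. If `p ∣ lam + 1` then modulo `p` the product
`D Dᵀ` vanishes while `D + Dᵀ = -1 - J` has corank at most one, so `2 rank D` lies between `n - 1`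
and `n`. If `p ∣ n` then `D² = (lam + 1) J` has rank one, so `2 rank D ≤ n + 1`. Equality needs more
than double regularity. For the Szekeres tournament the off-diagonal blocks `-Q` and `-(1 + Q)` differ
by the identity, so an idempotent power of `1 + Q` splits the space into a part where `1 + Q` is
invertible and one where `Q` is; this gives the lower bound for the rank (`IsSkewPair.le_rank`). The
rank determines the dimension of `K/pK`.

Finally `K/aK` is free over `ℤ/a`, for `a = lam + 1` and `a = n`, as soon as all `K/pK` with `p ∣ a`
have the same dimension and `(a/p) y ∈ aK` implies `y ∈ pK`
(`nonempty_quotient_addEquiv_pi_zmod`). If `y` is represented by `x ∈ L`, so that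
`(a/p) x = D u + a z`, applying `Dᵀ` and dividing by `a/p` gives, modulo `p`, that `-x = D x` when
`a = lam + 1`, and that `D x` is constant when `a = n`. In the second case `x` is in the range of
`D` modulo `p` because, by the value of the rank, that range contains the kernel.
-/

/-! ### Free quotients of abelian groups over `ℤ/a` -/

section FreeQuotients

variable {K : Type*} [AddCommGroup K]

/-- The family `x` induces a basis of the `ℤ/p`-module `K/pK`. Everything is phrased with integer
coefficients and elements of `K`, so that no quotient has to be formed. -/
structure IsBasisMod (p : ℕ) {ι : Type*} [Fintype ι] (x : ι → K) : Prop where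
  span : ∀ y : K, ∃ (c : ι → ℤ) (z : K), y = ∑ i, c i • x i + p • z
  indep : ∀ (c : ι → ℤ) (z : K), ∑ i, c i • x i = p • z → ∀ i, (p : ℤ) ∣ c i

theorem IsBasisMod.congr {p : ℕ} {ι : Type*} [Fintype ι] {x x' : ι → K} (hx : IsBasisMod p x)
    (h : ∀ i, ∃ w, x' i = x i + p • w) : IsBasisMod p x' := by
  choose w hw using h
  have key (c : ι → ℤ) : ∑ i, c i • x' i = ∑ i, c i • x i + p • ∑ i, c i • w i := by
    simp only [hw, smul_add, Finset.sum_add_distrib, Finset.smul_sum]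
    congr 1
    exact Finset.sum_congr rfl fun i _ => smul_comm _ _ _
  constructor
  · intro y
    obtain ⟨c, z, rfl⟩ := hx.span y
    refine ⟨c, z - ∑ i, c i • w i, ?_⟩
    rw [key, smul_sub]
    abel
  · intro c z hc
    refine hx.indep c (z - ∑ i, c i • w i) ?_
    rw [smul_sub, ← hc, key]
    abel

/-- Bases of `K/pK` of the same size, one for each prime `p ∣ a`, lift to a single family, by the
Chinese remainder theorem. -/
theorem exists_isBasisMod_forall {a r : ℕ} (ha : a ≠ 0)
    (h : ∀ p : ℕ, p.Prime → p ∣ a → ∃ x : Fin r → K, IsBasisMod p x) :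
    ∃ x : Fin r → K, ∀ p : ℕ, p.Prime → p ∣ a → IsBasisMod p x := by
  have h' : ∀ p : ℕ, ∃ x : Fin r → K, p.Prime → p ∣ a → IsBasisMod p x := by
    intro p
    by_cases hp : p.Prime ∧ p ∣ a
    · obtain ⟨x, hx⟩ := h p hp.1 hp.2
      exact ⟨x, fun _ _ => hx⟩
    · exact ⟨0, fun h1 h2 => absurd ⟨h1, h2⟩ hp⟩
  choose x hx using h'
  have hcop : Set.Pairwise (a.primeFactors : Set ℕ) (Function.onFun Nat.Coprime id) := by
    intro p hp q hq hpq
    exact (Nat.coprime_primes (Nat.prime_of_mem_primeFactors hp)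
      (Nat.prime_of_mem_primeFactors hq)).2 hpq
  have hne : ∀ p ∈ a.primeFactors, id p ≠ 0 := fun p hp =>
    (Nat.prime_of_mem_primeFactors hp).ne_zero
  let u : ℕ → ℕ := fun p =>
    (Nat.chineseRemainderOfFinset (fun q => if q = p then 1 else 0) id a.primeFactors hne hcop).1
  have hu : ∀ p, ∀ q ∈ a.primeFactors, u p ≡ (if q = p then 1 else 0) [MOD q] := fun p =>
    (Nat.chineseRemainderOfFinset (fun q => if q = p then 1 else 0) id a.primeFactors hne hcop).2
  refine ⟨fun i => ∑ q ∈ a.primeFactors, u q • x q i, fun p hp hpa => ?_⟩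
  have hmem : p ∈ a.primeFactors := Nat.mem_primeFactors.2 ⟨hp, hpa, ha⟩
  refine (hx p hp hpa).congr fun i => ?_
  have hq : ∀ q, ∃ w, q ∈ a.primeFactors → u q • x q i = (if p = q then x q i else 0) + p • w := by
    intro q
    obtain ⟨k, hk⟩ := (Nat.modEq_iff_dvd.1 (hu q p hmem).symm)
    refine ⟨k • x q i, fun _ => ?_⟩
    have h1 : ((u q : ℕ) : ℤ) = ((if p = q then 1 else 0 : ℕ) : ℤ) + p * k := by
      rw [← hk]; ring
    rw [← natCast_zsmul (x q i) (u q), h1, add_smul, mul_smul, natCast_zsmul (k • x q i) p]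
    split_ifs <;> simp
  choose w hw using hq
  refine ⟨∑ q ∈ a.primeFactors, w q, ?_⟩
  rw [Finset.sum_congr rfl fun q hq => hw q hq, Finset.sum_add_distrib, Finset.smul_sum]
  simp only [Finset.sum_ite_eq, hmem, if_true]

theorem exists_add_smul_of_forall_prime {ι : Type*} [Fintype ι] {x : ι → K} {a : ℕ} (ha : a ≠ 0)
    (h : ∀ p : ℕ, p.Prime → p ∣ a → ∀ y : K, ∃ (c : ι → ℤ) (z : K), y = ∑ i, c i • x i + p • z)
    (y : K) : ∃ (c : ι → ℤ) (z : K), y = ∑ i, c i • x i + a • z := by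
  induction a using induction_on_primes generalizing y with
  | zero => exact absurd rfl ha
  | one => exact ⟨0, y, by simp⟩
  | prime_mul p a hp ih =>
    obtain ⟨c, z, rfl⟩ := ih (right_ne_zero_of_mul ha)
      (fun q hq hqa => h q hq (hqa.mul_left p)) y
    obtain ⟨c', z', rfl⟩ := h p hp (dvd_mul_right p a) z
    refine ⟨c + (a : ℤ) • c', z', ?_⟩
    simp only [smul_add, Finset.smul_sum, Pi.add_apply, Pi.smul_apply, add_smul,
      Finset.sum_add_distrib, mul_smul, natCast_zsmul, add_assoc, smul_assoc]
    rw [smul_comm p a z']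

/-- If, for every prime `p ∣ a`, the family `x` is independent modulo `p` and the `a/p`-torsion of
`K/aK` is contained in its multiples of `p`, then `x` is independent modulo `a`. -/
theorem dvd_of_sum_eq_smul {ι : Type*} [Fintype ι] {x : ι → K} {a : ℕ}
    (h : ∀ p : ℕ, p.Prime → p ∣ a → IsBasisMod p x)
    (htor : ∀ p : ℕ, p.Prime → p ∣ a → ∀ y z : K, (a / p) • y = a • z → ∃ w, y = p • w)
    (ha : a ≠ 0) {c : ι → ℤ} {z : K} (hc : ∑ i, c i • x i = a • z) (i : ι) : (a : ℤ) ∣ c i := by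
  -- Raise a common divisor `d ∣ a` of the coefficients one prime at a time.
  suffices ∀ d : ℕ, d ∣ a → ∀ i, (d : ℤ) ∣ c i from this a dvd_rfl i
  intro d
  induction d using induction_on_primes with
  | zero => intro h0; exact absurd (zero_dvd_iff.1 h0) ha
  | one => intro _ i; simp
  | prime_mul p d hp ih =>
    rintro ⟨k, hk⟩
    choose c' hc' using ih ⟨p * k, by rw [hk]; ring⟩
    have hpa : p ∣ a := ⟨d * k, by rw [hk]; ring⟩
    have hdiv : a / p = k * d := by
      rw [hk, mul_assoc, Nat.mul_div_cancel_left _ hp.pos, mul_comm]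
    have h1 : d • ∑ i, c' i • x i = a • z := by
      rw [← hc, Finset.smul_sum]
      refine Finset.sum_congr rfl fun i _ => ?_
      rw [hc' i, mul_smul, natCast_zsmul]
    obtain ⟨w, hw⟩ := htor p hp hpa (∑ i, c' i • x i) (k • z) (by
      rw [hdiv, mul_smul, h1, smul_comm])
    intro i
    rw [hc' i, Nat.cast_mul, mul_comm]
    exact mul_dvd_mul_left _ ((h p hp hpa).indep c' w hw i)

/-- A criterion for `K/aK` to be a free `ℤ/a`-module of rank `r`: each `K/pK` with `p ∣ a` prime has
dimension `r`, and multiplication by `a/p` on `K/aK` has no larger kernel than it must. -/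
theorem nonempty_quotient_addEquiv_pi_zmod {a r : ℕ} (ha : a ≠ 0)
    (h : ∀ p : ℕ, p.Prime → p ∣ a → ∃ x : Fin r → K, IsBasisMod p x)
    (htor : ∀ p : ℕ, p.Prime → p ∣ a → ∀ y z : K, (a / p) • y = a • z → ∃ w, y = p • w) :
    Nonempty ((K ⧸ (nsmulAddMonoidHom (α := K) a).range) ≃+ (Fin r → ZMod a)) := by
  obtain ⟨x, hx⟩ := exists_isBasisMod_forall ha h
  let f : (Fin r → ℤ) →+ K ⧸ (nsmulAddMonoidHom (α := K) a).range :=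
    (QuotientAddGroup.mk' _).comp
      { toFun := fun c => ∑ i, c i • x i
        map_zero' := by simp
        map_add' := fun c d => by simp [add_smul, Finset.sum_add_distrib] }
  let g : (Fin r → ℤ) →+ (Fin r → ZMod a) := (Int.castAddHom (ZMod a)).compLeft (Fin r)
  have hf0 (c : Fin r → ℤ) : f c = 0 ↔ ∃ z, a • z = ∑ i, c i • x i :=
    (QuotientAddGroup.eq_zero_iff _).trans AddMonoidHom.mem_range
  have hf : Function.Surjective f := by
    intro y
    obtain ⟨y, rfl⟩ := QuotientAddGroup.mk'_surjective _ y
    obtain ⟨c, z, rfl⟩ := exists_add_smul_of_forall_prime ha (fun p hp hpa => (hx p hp hpa).span) y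
    refine ⟨c, ?_⟩
    refine (QuotientAddGroup.eq.2 ?_)
    exact ⟨z, by simp [nsmulAddMonoidHom]⟩
  have hg : Function.Surjective g := by
    intro y
    choose c hc using fun i => ZMod.intCast_surjective (y i)
    exact ⟨c, funext hc⟩
  have hker : f.ker = g.ker := by
    ext c
    rw [AddMonoidHom.mem_ker, AddMonoidHom.mem_ker, hf0, funext_iff]
    have hgc (i) : g c i = (0 : Fin r → ZMod a) i ↔ (a : ℤ) ∣ c i :=
      ZMod.intCast_zmod_eq_zero_iff_dvd (c i) a
    simp only [hgc]
    constructor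
    · rintro ⟨z, hz⟩
      exact dvd_of_sum_eq_smul hx htor ha hz.symm
    · intro hc
      choose d hd using hc
      refine ⟨∑ i, d i • x i, ?_⟩
      rw [Finset.smul_sum]
      refine Finset.sum_congr rfl fun i _ => ?_
      rw [hd i, mul_smul, natCast_zsmul]
  exact ⟨(QuotientAddGroup.quotientKerEquivOfSurjective f hf).symm.trans
    ((QuotientAddGroup.quotientAddEquivOfEq hker).trans
      (QuotientAddGroup.quotientKerEquivOfSurjective g hg))⟩

theorem nonempty_addEquiv_prod_quotient {a b : ℕ} (hab : a.Coprime b)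
    (h : ∀ x : K, (a * b) • x = 0) :
    Nonempty (K ≃+ (K ⧸ (nsmulAddMonoidHom (α := K) a).range) ×
      (K ⧸ (nsmulAddMonoidHom (α := K) b).range)) := by
  obtain ⟨u, v, huv⟩ := Nat.isCoprime_iff_coprime.2 hab
  have hsum (x : K) : u • a • x + v • b • x = x := by
    rw [← natCast_zsmul x a, ← natCast_zsmul x b, ← mul_smul, ← mul_smul, ← add_smul, huv, one_smul]
  let f : K →+ (K ⧸ (nsmulAddMonoidHom (α := K) a).range) ×
      (K ⧸ (nsmulAddMonoidHom (α := K) b).range) :=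
    (QuotientAddGroup.mk' _).prod (QuotientAddGroup.mk' _)
  refine ⟨AddEquiv.ofBijective f ⟨?_, ?_⟩⟩
  · rw [injective_iff_map_eq_zero]
    intro x hx
    obtain ⟨h1, h2⟩ := Prod.ext_iff.1 hx
    obtain ⟨y, hy⟩ := (QuotientAddGroup.eq_zero_iff x).1 h1
    obtain ⟨z, hz⟩ := (QuotientAddGroup.eq_zero_iff x).1 h2
    have hy' : a • y = x := hy
    have hz' : b • z = x := hz
    have e1 : a • x = 0 := by rw [← hz', ← mul_smul, h]
    have e2 : b • x = 0 := by rw [← hy', ← mul_smul, mul_comm, h]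
    rw [← hsum x, e1, e2, smul_zero, smul_zero, add_zero]
  · rintro ⟨x, y⟩
    obtain ⟨x, rfl⟩ := QuotientAddGroup.mk'_surjective _ x
    obtain ⟨y, rfl⟩ := QuotientAddGroup.mk'_surjective _ y
    refine ⟨v • b • x + u • a • y, Prod.ext (QuotientAddGroup.eq.2 ⟨u • (x - y), ?_⟩)
      (QuotientAddGroup.eq.2 ⟨v • (y - x), ?_⟩)⟩
    · change a • u • (x - y) = -(v • b • x + u • a • y) + x
      nth_rw 3 [← hsum x]
      rw [smul_comm a u, smul_sub, smul_sub]
      abel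
    · change b • v • (y - x) = -(v • b • x + u • a • y) + y
      nth_rw 3 [← hsum y]
      rw [smul_comm b v, smul_sub, smul_sub]
      abel

end FreeQuotients

/-! ### Laplacian matrices of doubly regular tournaments -/

section DoublyRegular

theorem Matrix.rank_add_le_add {V F : Type*} [Fintype V] [Field F] (M N : Matrix V V F) :
    (M + N).rank ≤ M.rank + N.rank := by
  have h : LinearMap.range (M + N).mulVecLin ≤
      LinearMap.range M.mulVecLin ⊔ LinearMap.range N.mulVecLin := by
    rintro _ ⟨x, rfl⟩
    rw [Matrix.mulVecLin_add]
    exact Submodule.add_mem_sup ⟨x, rfl⟩ ⟨x, rfl⟩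
  exact (Submodule.finrank_mono h).trans (Submodule.finrank_add_le_finrank_add_finrank _ _)

/-- The square matrix all of whose entries are `1`. -/
def allOnes (V R : Type*) [One R] : Matrix V V R := Matrix.of fun _ _ => 1

@[simp] theorem allOnes_apply {V R : Type*} [One R] (v w : V) : allOnes V R v w = 1 := rfl

theorem allOnes_transpose {V R : Type*} [One R] : (allOnes V R).transpose = allOnes V R := rfl

variable {V : Type*} [Fintype V]

theorem allOnes_mul_self {R : Type*} [CommRing R] :
    allOnes V R * allOnes V R = (Fintype.card V : R) • allOnes V R := by
  ext v w
  simp [Matrix.mul_apply]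

theorem allOnes_mulVec {R : Type*} [CommRing R] (x : V → R) (v : V) :
    (allOnes V R).mulVec x v = ∑ w, x w := by
  simp [Matrix.mulVec, dotProduct]

variable [DecidableEq V]

/-- The equations satisfied by the Laplacian matrix of a doubly regular tournament on `4 lam + 3`
vertices, over any coefficient ring: the tournament property, the number of common out-neighbours
of two vertices, and the vanishing of the column sums. -/
structure IsDoublyRegularLaplacian {R : Type*} [CommRing R] (lam : ℕ) (D : Matrix V V R) :
    Prop where
  card_eq : Fintype.card V = 4 * lam + 3
  add_transpose : D + D.transpose = (4 * lam + 3 : R) • 1 - allOnes V R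
  transpose_mul : D.transpose * D = (lam + 1 : R) • ((4 * lam + 3 : R) • 1 - allOnes V R)
  allOnes_mul : allOnes V R * D = 0

namespace IsDoublyRegularLaplacian

theorem map {R S : Type*} [CommRing R] [CommRing S] {lam : ℕ} {D : Matrix V V R}
    (hD : IsDoublyRegularLaplacian lam D) (f : R →+* S) :
    IsDoublyRegularLaplacian lam (D.map f) := by
  have hJ : (allOnes V R).map f = allOnes V S := by ext; simp
  have hs (c : R) (M : Matrix V V R) : (c • M).map f = f c • M.map f := by ext; simp
  have hsub (M N : Matrix V V R) : (M - N).map f = M.map f - N.map f := by ext; simp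
  have hc : f (4 * lam + 3 : R) = 4 * lam + 3 := by
    rw [map_add, map_mul, map_natCast, map_ofNat, map_ofNat]
  have hc' : f (lam + 1 : R) = lam + 1 := by rw [map_add, map_natCast, map_one]
  have h1 : (1 : Matrix V V R).map f = 1 := Matrix.map_one f (map_zero f) (map_one f)
  have hadd (M N : Matrix V V R) : (M + N).map f = M.map f + N.map f := by ext; simp
  refine ⟨hD.card_eq, ?_, ?_, ?_⟩
  · have := congrArg (fun M => M.map f) hD.add_transpose
    simpa [-map_add, -map_mul, hc, hc', hJ, hs, hsub, h1, hadd, Matrix.transpose_map] using this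
  · have := congrArg (fun M => M.map f) hD.transpose_mul
    simpa [-map_add, -map_mul, hc, hc', hJ, hs, hsub, h1, hadd, Matrix.transpose_map,
      Matrix.map_mul] using this
  · have := congrArg (fun M => M.map f) hD.allOnes_mul
    simp only [Matrix.map_mul, hJ] at this
    rw [this]
    ext; simp

section Ring

variable {R : Type*} [CommRing R] {lam : ℕ} {D : Matrix V V R}
  (hD : IsDoublyRegularLaplacian lam D)

include hD

theorem allOnes_mul_sub :
    allOnes V R * ((4 * lam + 3 : R) • 1 - allOnes V R) = 0 := by
  rw [mul_sub, allOnes_mul_self, hD.card_eq]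
  simp

theorem mul_allOnes : D * allOnes V R = 0 := by
  have h : allOnes V R * D.transpose = 0 := by
    have := congrArg (allOnes V R * ·) hD.add_transpose
    simpa only [hD.allOnes_mul_sub, mul_add, hD.allOnes_mul, zero_add] using this
  have := congrArg Matrix.transpose h
  rwa [Matrix.transpose_mul, Matrix.transpose_transpose, allOnes_transpose,
    Matrix.transpose_zero] at this

theorem transpose_eq : D.transpose = (4 * lam + 3 : R) • 1 - allOnes V R - D :=
  eq_sub_of_add_eq' hD.add_transpose

theorem mul_transpose :
    D * D.transpose = (lam + 1 : R) • ((4 * lam + 3 : R) • 1 - allOnes V R) := by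
  have h := hD.transpose_mul
  rw [hD.transpose_eq, sub_mul, sub_mul, hD.allOnes_mul] at h
  rw [hD.transpose_eq, mul_sub, mul_sub, hD.mul_allOnes, ← h]
  simp

theorem mul_self : D * D = (4 * lam + 3 : R) • D -
    (lam + 1 : R) • ((4 * lam + 3 : R) • 1 - allOnes V R) := by
  have h := hD.transpose_mul
  rw [hD.transpose_eq, sub_mul, sub_mul, hD.allOnes_mul] at h
  rw [← h]
  simp

theorem sum_mulVec (x : V → R) : ∑ v, D.mulVec x v = 0 := by
  have v : V := (Fintype.card_pos_iff.1 (by have := hD.card_eq; omega)).some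
  rw [← allOnes_mulVec (D.mulVec x) v, Matrix.mulVec_mulVec, hD.allOnes_mul]
  simp

theorem transpose_mulVec {x : V → R} (hx : ∑ v, x v = 0) :
    D.transpose.mulVec x = (4 * lam + 3 : R) • x - D.mulVec x := by
  rw [hD.transpose_eq, Matrix.sub_mulVec, Matrix.sub_mulVec, Matrix.smul_mulVec, Matrix.one_mulVec]
  congr 1
  ext v
  simp [allOnes_mulVec, hx]

theorem transpose_mulVec_mulVec (y : V → R) :
    D.transpose.mulVec (D.mulVec y) =
      (lam + 1 : R) • ((4 * lam + 3 : R) • y - fun _ => ∑ v, y v) := by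
  rw [Matrix.mulVec_mulVec, hD.transpose_mul, Matrix.smul_mulVec, Matrix.sub_mulVec,
    Matrix.smul_mulVec, Matrix.one_mulVec]
  congr 2
  ext v
  simp [allOnes_mulVec]

theorem mulVec_transpose_mulVec {x : V → R} (hx : ∑ v, x v = 0) :
    D.mulVec (D.transpose.mulVec x) = ((lam + 1) * (4 * lam + 3) : R) • x := by
  rw [Matrix.mulVec_mulVec, hD.mul_transpose, Matrix.smul_mulVec, Matrix.sub_mulVec,
    Matrix.smul_mulVec, Matrix.one_mulVec, mul_smul]
  congr 1
  ext v
  simp [allOnes_mulVec, hx]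

end Ring

section Field

variable {F : Type*} [Field F] {lam : ℕ} {D : Matrix V V F}
  (hD : IsDoublyRegularLaplacian lam D)

include hD

theorem rank_eq_of_succ_eq_zero (h0 : (lam + 1 : F) = 0) : D.rank = 2 * lam + 1 := by
  have hn : (4 * lam + 3 : F) = -1 := by linear_combination 4 * h0
  have h1 := Matrix.rank_add_rank_le_card_of_mul_eq_zero
    (A := D) (B := D.transpose) (by rw [hD.mul_transpose, h0, zero_smul])
  rw [Matrix.rank_transpose, hD.card_eq] at h1
  have h2 : (-1 : Matrix V V F) = (D + D.transpose) + Matrix.vecMulVec 1 1 := by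
    rw [hD.add_transpose, hn]
    ext v w
    simp [Matrix.vecMulVec]
  have h3 : (-1 : Matrix V V F).rank = 4 * lam + 3 := by
    rw [Matrix.rank_of_isUnit _ (isUnit_one (M := Matrix V V F)).neg, hD.card_eq]
  have h4 := Matrix.rank_add_le_add (D + D.transpose) (Matrix.vecMulVec 1 1)
  have h5 := Matrix.rank_add_le_add D D.transpose
  have h6 := Matrix.rank_vecMulVec_le (1 : V → F) (1 : V → F)
  rw [← h2, h3] at h4
  rw [Matrix.rank_transpose] at h5
  omega

/-- In a characteristic dividing `4 lam + 3` one has `D² = (lam + 1) J`, of rank one, so that `D`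
annihilates a rank-one perturbation of itself, whose range lies in the range of `D`. -/
theorem exists_mul_eq_zero (h0 : (4 * lam + 3 : F) = 0) :
    ∃ w : V → F, D.mulVec (D.mulVec w) = (fun _ => (lam + 1 : F)) ∧
      D * (D - Matrix.vecMulVec (D.mulVec w) 1) = 0 := by
  have v : V := (Fintype.card_pos_iff.1 (by have := hD.card_eq; omega)).some
  have hsq : D * D = (lam + 1 : F) • allOnes V F := by
    rw [hD.mul_self, h0]
    simp
  have hw : D.mulVec (D.mulVec (Pi.single v 1)) = fun _ => (lam + 1 : F) := by
    rw [Matrix.mulVec_mulVec, hsq]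
    ext u
    simp
  refine ⟨Pi.single v 1, hw, ?_⟩
  rw [mul_sub, Matrix.mul_vecMulVec, hw, hsq]
  ext a b
  simp [Matrix.vecMulVec]

theorem rank_le_of_eq_zero (h0 : (4 * lam + 3 : F) = 0) : D.rank ≤ 2 * lam + 2 := by
  obtain ⟨w, -, hw⟩ := hD.exists_mul_eq_zero h0
  have h1 := Matrix.rank_add_rank_le_card_of_mul_eq_zero hw
  have h2 := Matrix.rank_add_le_add (D - Matrix.vecMulVec (D.mulVec w) 1)
    (Matrix.vecMulVec (D.mulVec w) 1)
  have h3 := Matrix.rank_vecMulVec_le (D.mulVec w) (1 : V → F)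
  rw [sub_add_cancel] at h2
  rw [hD.card_eq] at h1
  omega

/-- If the rank is as large as possible, the range of `D` contains its kernel, and with it every
vector whose image is constant. -/
theorem mem_range_of_mulVec_eq_const (h0 : (4 * lam + 3 : F) = 0) (hr : 2 * lam + 2 ≤ D.rank)
    {x : V → F} {c : F} (hx : D.mulVec x = fun _ => c) : ∃ y, D.mulVec y = x := by
  obtain ⟨w, hw, hw0⟩ := hD.exists_mul_eq_zero h0
  have hl : (lam + 1 : F) ≠ 0 := fun h =>
    one_ne_zero (α := F) (by linear_combination 4 * h - h0)
  set E := D - Matrix.vecMulVec (D.mulVec w) 1 with hE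
  -- The kernel of `D` has dimension `2 lam + 1`, hence it is the range of `E`.
  have hle : LinearMap.range E.mulVecLin ≤ LinearMap.ker D.mulVecLin := by
    rintro _ ⟨y, rfl⟩
    simp [Matrix.mulVec_mulVec, hw0]
  have hker : LinearMap.range E.mulVecLin = LinearMap.ker D.mulVecLin := by
    apply Submodule.eq_of_le_of_finrank_le hle
    have h1 := LinearMap.finrank_range_add_finrank_ker D.mulVecLin
    have h2 := Matrix.rank_add_le_add E (Matrix.vecMulVec (D.mulVec w) 1)
    have h3 := Matrix.rank_vecMulVec_le (D.mulVec w) (1 : V → F)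
    rw [hE, sub_add_cancel, ← hE] at h2
    rw [Module.finrank_fintype_fun_eq_card, hD.card_eq] at h1
    change _ ≤ E.rank
    change D.rank + _ = _ at h1
    omega
  have hx' : x - (c / (lam + 1)) • D.mulVec w ∈ LinearMap.ker D.mulVecLin := by
    rw [LinearMap.mem_ker, Matrix.mulVecLin_apply, Matrix.mulVec_sub, Matrix.mulVec_smul, hx, hw]
    ext v
    simp [hl]
  rw [← hker] at hx'
  obtain ⟨y, hy⟩ := hx'
  refine ⟨y - (∑ v, y v) • w + (c / (lam + 1)) • w, ?_⟩
  have hEy : E.mulVec y = D.mulVec y - (∑ v, y v) • D.mulVec w := by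
    rw [hE, Matrix.sub_mulVec, Matrix.vecMulVec_mulVec]
    ext v
    simp [dotProduct, mul_comm]
  rw [Matrix.mulVecLin_apply, hEy] at hy
  rw [Matrix.mulVec_add, Matrix.mulVec_sub, Matrix.mulVec_smul, Matrix.mulVec_smul, hy]
  abel

end Field

end IsDoublyRegularLaplacian

end DoublyRegular

/-! ### The critical group of a doubly regular tournament -/

section CriticalGroup

variable {V : Type*} [Fintype V]

/-- The lattice of integer vectors with coordinate sum zero. -/
def sumZero (V : Type*) [Fintype V] : AddSubgroup (V → ℤ) where
  carrier := {x | ∑ v, x v = 0}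
  zero_mem' := by simp
  add_mem' := by
    intro x y hx hy
    simp_all [Finset.sum_add_distrib]
  neg_mem' := by
    intro x hx
    simp_all

theorem mem_sumZero {x : V → ℤ} : x ∈ sumZero V ↔ ∑ v, x v = 0 := Iff.rfl

theorem exists_mem_sumZero_cast_eq {p : ℕ} {x : V → ZMod p} (hx : ∑ v, x v = 0) (v₀ : V) :
    ∃ y ∈ sumZero V, (fun v => (y v : ZMod p)) = x := by
  classical
  choose c hc using fun v => ZMod.intCast_surjective (x v)
  have h : ((∑ v, c v : ℤ) : ZMod p) = 0 := by
    rw [Int.cast_sum, ← hx]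
    exact Finset.sum_congr rfl fun v _ => hc v
  refine ⟨c - Pi.single v₀ (∑ v, c v), ?_, ?_⟩
  · simp [mem_sumZero, Finset.sum_sub_distrib]
  · ext v
    by_cases hv : v = v₀
    · subst hv
      simp only [Pi.sub_apply, Pi.single_eq_same, Int.cast_sub, h, hc, sub_zero]
    · simp [hv, hc]

theorem mulVec_cast (p : ℕ) (D : Matrix V V ℤ) (y : V → ℤ) :
    (D.map (Int.cast : ℤ → ZMod p)).mulVec (fun v => (y v : ZMod p)) =
      fun v => ((D.mulVec y v : ℤ) : ZMod p) := by
  ext v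
  simp [Matrix.mulVec, dotProduct]

theorem exists_eq_mulVec_add_smul {p : ℕ} {D : Matrix V V ℤ} {x : V → ℤ} {y : V → ZMod p}
    (h : (D.map (Int.cast : ℤ → ZMod p)).mulVec y = fun v => (x v : ZMod p)) :
    ∃ u z : V → ℤ, x = D.mulVec u + p • z := by
  choose u hu using fun v => ZMod.intCast_surjective (y v)
  obtain rfl : (fun v => (u v : ZMod p)) = y := funext hu
  rw [mulVec_cast] at h
  have h' (v : V) : (p : ℤ) ∣ x v - D.mulVec u v := by
    rw [← ZMod.intCast_zmod_eq_zero_iff_dvd, Int.cast_sub, sub_eq_zero]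
    exact (congrFun h v).symm
  choose z hz using h'
  refine ⟨u, z, funext fun v => ?_⟩
  simp [← hz]

-- The map `π` presents `K` as the quotient of the sum-zero lattice by the range of `D`.
variable [DecidableEq V] {lam : ℕ} {D : Matrix V V ℤ}
  (hD : IsDoublyRegularLaplacian lam D)
  {K : Type*} [AddCommGroup K] {π : sumZero V →+ K}
  (hker : ∀ x, π x = 0 ↔ ∃ u, D.mulVec u = x) (hsurj : Function.Surjective π)

namespace IsDoublyRegularLaplacian

include hD

theorem map_intCast (p : ℕ) :
    IsDoublyRegularLaplacian lam (D.map (Int.cast : ℤ → ZMod p)) :=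
  hD.map (Int.castRingHom (ZMod p))

include hker

theorem exists_eq_smul_of_eq_mulVec_add {p : ℕ} (hp : p ≠ 0) (x : sumZero V) {u z : V → ℤ}
    (h : (x : V → ℤ) = D.mulVec u + p • z) : ∃ w, π x = p • w := by
  have hz : z ∈ sumZero V := by
    have h1 : ∑ v, (D.mulVec u + p • z) v = 0 := by rw [← h]; exact x.2
    simp only [Pi.add_apply, Finset.sum_add_distrib, hD.sum_mulVec, zero_add, Pi.smul_apply,
      ← Finset.smul_sum] at h1
    exact (smul_eq_zero.1 h1).resolve_left hp
  refine ⟨π ⟨z, hz⟩, ?_⟩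
  rw [← sub_eq_zero, ← map_nsmul, ← map_sub, hker]
  refine ⟨u, ?_⟩
  simp [h]

include hsurj

/-- The dimension of `K/pK` is found from the rank of `D`, as `K/pK` is the quotient of the vectors
of sum zero over `ℤ/p` by the range of `D`. -/
theorem exists_isBasisMod {p r : ℕ} (hp : p.Prime)
    (hr : (D.map (Int.cast : ℤ → ZMod p)).rank + r = 4 * lam + 2) :
    ∃ x : Fin r → K, IsBasisMod p x := by
  have := Fact.mk hp
  have v₀ : V := (Fintype.card_pos_iff.1 (by have := hD.card_eq; omega)).some
  have hDp := hD.map_intCast p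
  set Dp := D.map (Int.cast : ℤ → ZMod p) with hDp_def
  let s : (V → ZMod p) →ₗ[ZMod p] ZMod p := ∑ v, LinearMap.proj v
  have hs (x) : s x = ∑ v, x v := by simp [s]
  have hs_surj : LinearMap.range s = ⊤ := by
    rw [LinearMap.range_eq_top]
    intro c
    exact ⟨Pi.single v₀ c, by simp [hs]⟩
  have hW := LinearMap.finrank_range_add_finrank_ker s
  rw [hs_surj, finrank_top, Module.finrank_self, Module.finrank_fintype_fun_eq_card,
    hD.card_eq] at hW
  let W := LinearMap.ker s
  have hRW : LinearMap.range Dp.mulVecLin ≤ W := by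
    rintro _ ⟨y, rfl⟩
    rw [LinearMap.mem_ker, hs, Matrix.mulVecLin_apply, hDp.sum_mulVec]
  let R : Submodule (ZMod p) W := (LinearMap.range Dp.mulVecLin).comap W.subtype
  have hR : Module.finrank (ZMod p) R = Dp.rank :=
    (Submodule.comapSubtypeEquivOfLe hRW).finrank_eq
  have hQ : Module.finrank (ZMod p) (W ⧸ R) = r := by
    have := Submodule.finrank_quotient_add_finrank R
    change _ + Module.finrank (ZMod p) W = _ at hW
    omega
  let b := Module.finBasisOfFinrankEq (ZMod p) (W ⧸ R) hQ
  choose w hw using fun i => R.mkQ_surjective (b i)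
  have hlift : ∀ i, ∃ y : sumZero V, (fun v => ((y : V → ℤ) v : ZMod p)) = (w i : V → ZMod p) := by
    intro i
    obtain ⟨y, hy, h⟩ := exists_mem_sumZero_cast_eq (x := (w i : V → ZMod p))
      (by rw [← hs]; exact (w i).2) v₀
    exact ⟨⟨y, hy⟩, h⟩
  choose x hx using hlift
  -- Reduction modulo `p`, as a map from the sum-zero lattice to the quotient.
  have hred (y : sumZero V) : (fun v => ((y : V → ℤ) v : ZMod p)) ∈ W := by
    rw [LinearMap.mem_ker, hs, ← Int.cast_sum, mem_sumZero.1 y.2, Int.cast_zero]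
  let ρ : sumZero V →+ W ⧸ R := (R.mkQ.toAddMonoidHom).comp
    { toFun := fun y => ⟨_, hred y⟩
      map_zero' := by ext; simp
      map_add' := fun y z => by ext; simp }
  have hρ (y : sumZero V) : ρ y = 0 ↔ ∃ u z : V → ℤ, (y : V → ℤ) = D.mulVec u + p • z := by
    refine (Submodule.Quotient.mk_eq_zero R).trans ?_
    constructor
    · rintro ⟨u, hu⟩
      exact exists_eq_mulVec_add_smul hu
    · rintro ⟨u, z, h⟩
      refine ⟨fun v => (u v : ZMod p), ?_⟩
      rw [Matrix.mulVecLin_apply, hDp_def, mulVec_cast]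
      ext v
      simp [h]
  have hρx (i) : ρ (x i) = b i := by
    rw [← hw i]
    exact congrArg R.mkQ (Subtype.ext (hx i))
  have hρsum (c : Fin r → ℤ) : ρ (∑ i, c i • x i) = ∑ i, (c i : ZMod p) • b i := by
    rw [map_sum]
    refine Finset.sum_congr rfl fun i _ => ?_
    rw [map_zsmul, hρx, Int.cast_smul_eq_zsmul]
  refine ⟨fun i => π (x i), ?_, ?_⟩
  · intro y
    obtain ⟨y, rfl⟩ := hsurj y
    choose c hc using fun i => ZMod.intCast_surjective (b.repr (ρ y) i)
    have h0 : ρ (y - ∑ i, c i • x i) = 0 := by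
      simp only [map_sub, hρsum, hc, b.sum_repr, sub_self]
    obtain ⟨u, z, h⟩ := (hρ _).1 h0
    obtain ⟨k, hk⟩ := hD.exists_eq_smul_of_eq_mulVec_add hker hp.ne_zero _ h
    refine ⟨c, k, ?_⟩
    rw [← hk, map_sub, map_sum]
    simp
  · intro c z hc i
    obtain ⟨z, rfl⟩ := hsurj z
    have h0 : π (∑ i, c i • x i - p • z) = 0 := by
      rw [map_sub, map_sum, map_nsmul, ← hc, sub_eq_zero]
      simp
    obtain ⟨u, hu⟩ := (hker _).1 h0
    have h1 : ρ (∑ i, c i • x i) = 0 := by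
      rw [hρ]
      exact ⟨u, z, by rw [hu]; simp⟩
    rw [hρsum] at h1
    have := Fintype.linearIndependent_iff.1 b.linearIndependent _ h1 i
    exact (ZMod.intCast_zmod_eq_zero_iff_dvd _ _).1 this

omit hsurj in
/-- The result of applying `Dᵀ` to a relation `k y - a z = D u`. -/
theorem exists_transpose_mulVec_relation {a k : ℕ} {y z : sumZero V} (h : k • π y = a • π z) :
    ∃ u : V → ℤ, ∀ v, (k : ℤ) * ((4 * lam + 3) * (y : V → ℤ) v - D.mulVec y v) =
      a * ((4 * lam + 3) * (z : V → ℤ) v - D.mulVec z v) +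
        (lam + 1) * ((4 * lam + 3) * u v - ∑ w, u w) := by
  have h0 : π (k • y - a • z) = 0 := by rw [map_sub, map_nsmul, map_nsmul, h, sub_self]
  obtain ⟨u, hu⟩ := (hker _).1 h0
  refine ⟨u, fun v => ?_⟩
  have h1 := hD.transpose_mulVec_mulVec u
  rw [hu] at h1
  have h2 := hD.transpose_mulVec (mem_sumZero.1 y.2)
  have h3 := hD.transpose_mulVec (mem_sumZero.1 z.2)
  have h4 : D.transpose.mulVec ((k • y - a • z : sumZero V) : V → ℤ) =
      (k : ℤ) • D.transpose.mulVec y - (a : ℤ) • D.transpose.mulVec z := by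
    rw [← Matrix.mulVec_smul, ← Matrix.mulVec_smul, ← Matrix.mulVec_sub]
    simp
  rw [h4, h2, h3] at h1
  have h5 := congrFun h1 v
  simp only [Pi.sub_apply, Pi.smul_apply, smul_eq_mul] at h5
  linarith

/-- The relation obtained from `Dᵀ` and divided by `(lam + 1)/p` reads `-x ≡ D x` modulo `p`. -/
theorem exists_eq_smul_of_dvd_succ {p : ℕ} (hp : p.Prime) (hpa : p ∣ lam + 1) (y z : K)
    (h : ((lam + 1) / p) • y = (lam + 1) • z) : ∃ w, y = p • w := by
  obtain ⟨y, rfl⟩ := hsurj y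
  obtain ⟨z, rfl⟩ := hsurj z
  obtain ⟨u, hu⟩ := hD.exists_transpose_mulVec_relation hker h
  obtain ⟨q, hq⟩ := hpa
  have hq0 : (q : ℤ) ≠ 0 := by
    rintro h0
    have : q = 0 := by exact_mod_cast h0
    simp [this] at hq
  rw [hq, Nat.mul_div_cancel_left _ hp.pos] at hu
  have hqZ : (lam + 1 : ℤ) = p * q := by exact_mod_cast hq
  -- The witnesses come from `4 lam + 3 = 4 p q - 1`.
  refine hD.exists_eq_smul_of_eq_mulVec_add hker hp.ne_zero y (u := -y)
    (z := fun v => 4 * q * (y : V → ℤ) v - ((4 * lam + 3) * (z : V → ℤ) v - D.mulVec z v) -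
        ((4 * lam + 3) * u v - ∑ w, u w)) (funext fun v => ?_)
  have h1 := hu v
  rw [hqZ] at h1
  push_cast at h1
  simp only [Matrix.mulVec_neg, Pi.add_apply, Pi.neg_apply, Pi.smul_apply]
  rw [nsmul_eq_mul]
  apply mul_left_cancel₀ hq0
  linear_combination (-1 : ℤ) * h1 + 4 * q * (y : V → ℤ) v * hqZ

/-- The relation obtained from `Dᵀ` and divided by `(4 lam + 3)/p` says that `D x` is constant
modulo `p`; by the rank hypothesis `x` then lies in the range of `D` modulo `p`. -/
theorem exists_eq_smul_of_dvd {p : ℕ} (hp : p.Prime) (hpa : p ∣ 4 * lam + 3)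
    (hr : 2 * lam + 2 ≤ (D.map (Int.cast : ℤ → ZMod p)).rank) (y z : K)
    (h : ((4 * lam + 3) / p) • y = (4 * lam + 3) • z) : ∃ w, y = p • w := by
  have := Fact.mk hp
  have v₀ : V := (Fintype.card_pos_iff.1 (by have := hD.card_eq; omega)).some
  obtain ⟨y, rfl⟩ := hsurj y
  obtain ⟨z, rfl⟩ := hsurj z
  obtain ⟨u, hu⟩ := hD.exists_transpose_mulVec_relation hker h
  obtain ⟨q, hq⟩ := hpa
  have hq0 : (q : ℤ) ≠ 0 := by
    rintro h0
    have : q = 0 := by exact_mod_cast h0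
    simp [this] at hq
  rw [hq, Nat.mul_div_cancel_left _ hp.pos] at hu
  have hqZ : (4 * lam + 3 : ℤ) = p * q := by exact_mod_cast hq
  have h0 : (4 * lam + 3 : ZMod p) = 0 := by
    have : ((4 * lam + 3 : ℕ) : ZMod p) = 0 := (ZMod.natCast_eq_zero_iff _ _).2 ⟨q, hq⟩
    exact_mod_cast this
  -- `q` divides `(lam + 1) ∑ u`; the quotient is the constant value of `D y` modulo `p`.
  obtain ⟨s, hs⟩ : ∃ s : ℤ, (lam + 1) * ∑ w, u w = q * s := by
    refine ⟨p * ((4 * lam + 3) * (z : V → ℤ) v₀ - D.mulVec z v₀) + (lam + 1) * p * u v₀ -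
      ((4 * lam + 3) * (y : V → ℤ) v₀ - D.mulVec y v₀), ?_⟩
    have h1 := hu v₀
    push_cast at h1
    linear_combination h1 + (lam + 1) * u v₀ * hqZ
  have hconst : (D.map (Int.cast : ℤ → ZMod p)).mulVec (fun v => ((y : V → ℤ) v : ZMod p)) =
      fun _ => (s : ZMod p) := by
    rw [mulVec_cast]
    ext v
    rw [← sub_eq_zero, ← Int.cast_sub, ZMod.intCast_zmod_eq_zero_iff_dvd]
    refine ⟨q * (y : V → ℤ) v - ((4 * lam + 3) * (z : V → ℤ) v - D.mulVec z v) -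
      (lam + 1) * u v, ?_⟩
    have h1 := hu v
    push_cast at h1
    apply mul_left_cancel₀ hq0
    linear_combination (-1 : ℤ) * h1 + hs + (q * (y : V → ℤ) v - (lam + 1) * u v) * hqZ
  obtain ⟨x, hx⟩ := (hD.map_intCast p).mem_range_of_mulVec_eq_const h0 hr hconst
  obtain ⟨u', z', h'⟩ := exists_eq_mulVec_add_smul hx
  exact hD.exists_eq_smul_of_eq_mulVec_add hker hp.ne_zero y h'

omit hsurj hker in
theorem primeRank_of_dvd_succ {p : ℕ} (hp : p.Prime) (hpa : p ∣ lam + 1) :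
    D.primeRank p = 2 * lam + 1 := by
  have := Fact.mk hp
  have h0 : (lam + 1 : ZMod p) = 0 := by
    have : ((lam + 1 : ℕ) : ZMod p) = 0 := (ZMod.natCast_eq_zero_iff _ _).2 hpa
    exact_mod_cast this
  exact (hD.map_intCast p).rank_eq_of_succ_eq_zero h0

omit hsurj hker in
theorem primeRank_of_dvd {p : ℕ} (hp : p.Prime) (hpa : p ∣ 4 * lam + 3)
    (hr : 2 * lam + 2 ≤ (D.map (Int.cast : ℤ → ZMod p)).rank) :
    D.primeRank p = 2 * lam + 2 := by
  have := Fact.mk hp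
  have h0 : (4 * lam + 3 : ZMod p) = 0 := by
    have : ((4 * lam + 3 : ℕ) : ZMod p) = 0 := (ZMod.natCast_eq_zero_iff _ _).2 hpa
    exact_mod_cast this
  exact le_antisymm ((hD.map_intCast p).rank_le_of_eq_zero h0) hr

theorem nonempty_addEquiv
    (hr : ∀ p : ℕ, p.Prime → p ∣ 4 * lam + 3 →
      2 * lam + 2 ≤ (D.map (Int.cast : ℤ → ZMod p)).rank) :
    Nonempty (K ≃+ ((Fin (2 * lam + 1) → ZMod (lam + 1)) ×
      (Fin (2 * lam) → ZMod (4 * lam + 3)))) := by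
  have hcop : (lam + 1).Coprime (4 * lam + 3) := by
    rw [← Nat.isCoprime_iff_coprime]
    exact ⟨4, -1, by push_cast; ring⟩
  have hkill (x : K) : ((lam + 1) * (4 * lam + 3)) • x = 0 := by
    obtain ⟨x, rfl⟩ := hsurj x
    rw [← map_nsmul, hker]
    refine ⟨D.transpose.mulVec x, ?_⟩
    rw [hD.mulVec_transpose_mulVec (mem_sumZero.1 x.2)]
    ext v
    simp
  obtain ⟨e⟩ := nonempty_addEquiv_prod_quotient hcop hkill
  obtain ⟨e₁⟩ := nonempty_quotient_addEquiv_pi_zmod (K := K) (a := lam + 1) (r := 2 * lam + 1)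
    (by omega)
    (fun p hp hpa => hD.exists_isBasisMod hker hsurj hp (by
      have := hD.primeRank_of_dvd_succ hp hpa
      rw [Matrix.primeRank] at this
      omega))
    (fun p hp hpa => hD.exists_eq_smul_of_dvd_succ hker hsurj hp hpa)
  obtain ⟨e₂⟩ := nonempty_quotient_addEquiv_pi_zmod (K := K) (a := 4 * lam + 3) (r := 2 * lam)
    (by omega)
    (fun p hp hpa => hD.exists_isBasisMod hker hsurj hp (by
      have := hD.primeRank_of_dvd hp hpa (hr p hp hpa)
      rw [Matrix.primeRank] at this
      omega))
    (fun p hp hpa => hD.exists_eq_smul_of_dvd hker hsurj hp hpa (hr p hp hpa))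
  exact ⟨e.trans (e₁.prodCongr e₂)⟩

end IsDoublyRegularLaplacian

end CriticalGroup

/-! ### The Szekeres block matrix -/

section SzekeresMatrix

open Matrix

variable {G : Type*} [Fintype G] [DecidableEq G] {R : Type*} [CommRing R]

/-- The block matrix which, for the indicator matrices `P` and `Q` of the two blocks of a skew
difference family, is the Laplacian matrix of the Szekeres tournament; the columns are indexed by
the dominating vertices. -/
def szekeresMatrix (lam : ℕ) (P Q : Matrix G G R) :
    Matrix (SzekeresVertex G) (SzekeresVertex G) R :=
  Matrix.of fun
    | none, none => 2 * lam + 1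
    | none, some (Sum.inl _) => 0
    | none, some (Sum.inr _) => -1
    | some (Sum.inl _), none => -1
    | some (Sum.inr _), none => 0
    | some (Sum.inl g), some (Sum.inl h) => ((2 * lam + 1 : R) • 1 - P) g h
    | some (Sum.inr g), some (Sum.inl h) => (-(Q + 1)) g h
    | some (Sum.inl g), some (Sum.inr h) => (-Q) g h
    | some (Sum.inr g), some (Sum.inr h) => ((2 * lam + 1 : R) • 1 - P.transpose) g h

/-- The matrix form of the axioms of a skew difference family with two blocks, for the indicator
matrices `P` and `Q` of the blocks. -/
structure IsSkewPair (lam : ℕ) (P Q : Matrix G G R) : Prop where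
  card_eq : Fintype.card G = 2 * lam + 1
  add_transpose_left : P + Pᵀ = allOnes G R - 1
  add_transpose_right : Q + Qᵀ = allOnes G R - 1
  mul_transpose : Pᵀ * P + Qᵀ * Q = (lam + 1 : R) • 1 + (lam - 1 : R) • allOnes G R
  transpose_mul_comm : P * Pᵀ = Pᵀ * P
  mul_comm : P * Q = Q * P
  allOnes_mul_left : allOnes G R * P = (lam : R) • allOnes G R
  allOnes_mul_right : allOnes G R * Q = (lam : R) • allOnes G R
  mul_allOnes_left : P * allOnes G R = (lam : R) • allOnes G R
  mul_allOnes_right : Q * allOnes G R = (lam : R) • allOnes G R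

namespace IsSkewPair

variable {lam : ℕ} {P Q : Matrix G G R} (h : IsSkewPair lam P Q)

include h

theorem sum_left (g : G) : ∑ w, P w g = lam := by
  simpa [Matrix.mul_apply] using congrFun (congrFun h.allOnes_mul_left g) g

theorem sum_right (g : G) : ∑ w, Q w g = lam := by
  simpa [Matrix.mul_apply] using congrFun (congrFun h.allOnes_mul_right g) g

theorem sum_left' (g : G) : ∑ w, P g w = lam := by
  simpa [Matrix.mul_apply] using congrFun (congrFun h.mul_allOnes_left g) g

theorem transpose_mul_self_inl :
    ((2 * lam + 1 : R) • 1 - P)ᵀ * ((2 * lam + 1 : R) • 1 - P) + (-(Q + 1))ᵀ * (-(Q + 1)) =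
      (lam + 1 : R) • ((4 * lam + 3 : R) • 1 - allOnes G R) := by
  have e : ((2 * lam + 1 : R) • 1 - P)ᵀ * ((2 * lam + 1 : R) • 1 - P) +
      (-(Q + 1))ᵀ * (-(Q + 1)) = ((2 * lam + 1 : R) ^ 2) • 1 - (2 * lam + 1 : R) • (P + Pᵀ) +
        (Pᵀ * P + Qᵀ * Q) + (Q + Qᵀ) + 1 := by
    simp only [transpose_sub, transpose_smul, transpose_one, transpose_neg, transpose_add, mul_sub,
      sub_mul, mul_add, add_mul, smul_mul_assoc, mul_smul_comm, one_mul, mul_one, neg_mul, mul_neg]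
    module
  rw [e, h.add_transpose_left, h.add_transpose_right, h.mul_transpose]
  module

theorem transpose_mul_self_inr :
    allOnes G R + (-Q)ᵀ * (-Q) + ((2 * lam + 1 : R) • 1 - Pᵀ)ᵀ * ((2 * lam + 1 : R) • 1 - Pᵀ) =
      (lam + 1 : R) • ((4 * lam + 3 : R) • 1 - allOnes G R) := by
  have e : allOnes G R + (-Q)ᵀ * (-Q) +
      ((2 * lam + 1 : R) • 1 - Pᵀ)ᵀ * ((2 * lam + 1 : R) • 1 - Pᵀ) =
        ((2 * lam + 1 : R) ^ 2) • 1 - (2 * lam + 1 : R) • (P + Pᵀ) +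
        (Pᵀ * P + Qᵀ * Q) + allOnes G R := by
    simp only [transpose_sub, transpose_smul, transpose_one, transpose_neg, transpose_transpose,
      mul_sub, sub_mul, smul_mul_assoc, mul_smul_comm, one_mul, mul_one, neg_mul, mul_neg,
      h.transpose_mul_comm]
    module
  rw [e, h.add_transpose_left, h.mul_transpose]
  module

theorem transpose_mul_inl_inr :
    ((2 * lam + 1 : R) • 1 - P)ᵀ * (-Q) + (-(Q + 1))ᵀ * ((2 * lam + 1 : R) • 1 - Pᵀ) =
      (-(lam + 1) : R) • allOnes G R := by
  have hc : Qᵀ * Pᵀ = Pᵀ * Qᵀ := by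
    rw [← Matrix.transpose_mul, ← Matrix.transpose_mul, h.mul_comm]
  have hJ : Pᵀ * allOnes G R = (lam : R) • allOnes G R := by
    simpa [allOnes_transpose] using congrArg Matrix.transpose h.allOnes_mul_left
  have e : ((2 * lam + 1 : R) • 1 - P)ᵀ * (-Q) + (-(Q + 1))ᵀ * ((2 * lam + 1 : R) • 1 - Pᵀ) =
      -((2 * lam + 1 : R) • (Q + Qᵀ)) - (2 * lam + 1 : R) • 1 + Pᵀ + Pᵀ * (Q + Qᵀ) := by
    simp only [transpose_sub, transpose_smul, transpose_one, transpose_neg, transpose_add, mul_sub,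
      sub_mul, mul_add, add_mul, smul_mul_assoc, mul_smul_comm, one_mul, mul_one, neg_mul, mul_neg,
      hc]
    module
  rw [e, h.add_transpose_right, mul_sub, hJ, mul_one]
  module

theorem isDoublyRegularLaplacian : IsDoublyRegularLaplacian lam (szekeresMatrix lam P Q) := by
  set D := szekeresMatrix lam P Q with hDdef
  have hcard : (Fintype.card G : R) = 2 * lam + 1 := by rw [h.card_eq]; push_cast; ring
  have hone (g : G) : ∑ w, (1 : Matrix G G R) w g = 1 := by simp [Matrix.one_apply]
  -- Column sums and inner products of the four kinds of blocks.
  have hk (g : G) : ∑ w, ((2 * lam + 1 : R) • 1 - P) w g = lam + 1 := by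
    simp only [Matrix.sub_apply, Matrix.smul_apply, smul_eq_mul, Finset.sum_sub_distrib,
      ← Finset.mul_sum, hone, h.sum_left]
    ring
  have hk' (g : G) : ∑ w, ((2 * lam + 1 : R) • 1 - Pᵀ) w g = lam + 1 := by
    simp only [Matrix.sub_apply, Matrix.smul_apply, smul_eq_mul, Finset.sum_sub_distrib,
      ← Finset.mul_sum, hone, Matrix.transpose_apply, h.sum_left']
    ring
  have hQ1 (g : G) : ∑ w, (-(Q + 1)) w g = -(lam + 1) := by
    simp only [Matrix.neg_apply, Matrix.add_apply, Finset.sum_neg_distrib, Finset.sum_add_distrib,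
      hone, h.sum_right]
  have hQ0 (g : G) : ∑ w, (-Q) w g = -lam := by
    simp only [Matrix.neg_apply, Finset.sum_neg_distrib, h.sum_right]
  have e1 (g k : G) : ∑ w, ((2 * lam + 1 : R) • 1 - P) w g * ((2 * lam + 1 : R) • 1 - P) w k +
      ∑ w, (-(Q + 1)) w g * (-(Q + 1)) w k =
        ((lam + 1 : R) • ((4 * lam + 3 : R) • 1 - allOnes G R)) g k := by
    rw [← h.transpose_mul_self_inl]; rfl
  have e2 (g k : G) : 1 + ∑ w, (-Q) w g * (-Q) w k +
      ∑ w, ((2 * lam + 1 : R) • 1 - Pᵀ) w g * ((2 * lam + 1 : R) • 1 - Pᵀ) w k =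
        ((lam + 1 : R) • ((4 * lam + 3 : R) • 1 - allOnes G R)) g k := by
    rw [← h.transpose_mul_self_inr]; rfl
  have e3 (g k : G) : ∑ w, ((2 * lam + 1 : R) • 1 - P) w g * (-Q) w k +
      ∑ w, (-(Q + 1)) w g * ((2 * lam + 1 : R) • 1 - Pᵀ) w k =
        ((-(lam + 1) : R) • allOnes G R) g k := by
    rw [← h.transpose_mul_inl_inr]; rfl
  have e3' (g k : G) : ∑ w, (-Q) w g * ((2 * lam + 1 : R) • 1 - P) w k +
      ∑ w, ((2 * lam + 1 : R) • 1 - Pᵀ) w g * (-(Q + 1)) w k =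
        ((-(lam + 1) : R) • allOnes G R) g k := by
    rw [Finset.sum_congr rfl fun w _ => _root_.mul_comm ((-Q) w g) _,
      Finset.sum_congr rfl fun w _ =>
        _root_.mul_comm (((2 * lam + 1 : R) • 1 - Pᵀ) w g) _]
    exact e3 k g
  have hP (g k : G) := congrFun (congrFun h.add_transpose_left g) k
  have hQ (g k : G) := congrFun (congrFun h.add_transpose_right g) k
  simp only [Matrix.add_apply, Matrix.transpose_apply, Matrix.sub_apply, allOnes_apply] at hP hQ
  have hsymm (g k : G) : (1 : Matrix G G R) g k = (1 : Matrix G G R) k g := by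
    simp [Matrix.one_apply, eq_comm]
  have d00 : D none none = 2 * lam + 1 := rfl
  have d01 (g) : D none (some (Sum.inl g)) = 0 := rfl
  have d02 (g) : D none (some (Sum.inr g)) = -1 := rfl
  have d10 (g) : D (some (Sum.inl g)) none = -1 := rfl
  have d20 (g) : D (some (Sum.inr g)) none = 0 := rfl
  have d11 (g k) : D (some (Sum.inl g)) (some (Sum.inl k)) = ((2 * lam + 1 : R) • 1 - P) g k := rfl
  have d21 (g k) : D (some (Sum.inr g)) (some (Sum.inl k)) = (-(Q + 1)) g k := rfl
  have d12 (g k) : D (some (Sum.inl g)) (some (Sum.inr k)) = (-Q) g k := rfl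
  have d22 (g k) : D (some (Sum.inr g)) (some (Sum.inr k)) = ((2 * lam + 1 : R) • 1 - Pᵀ) g k := rfl
  have o11 (g k : G) : (1 : Matrix (SzekeresVertex G) (SzekeresVertex G) R)
      (some (Sum.inl g)) (some (Sum.inl k)) = (1 : Matrix G G R) g k := by simp [Matrix.one_apply]
  have o22 (g k : G) : (1 : Matrix (SzekeresVertex G) (SzekeresVertex G) R)
      (some (Sum.inr g)) (some (Sum.inr k)) = (1 : Matrix G G R) g k := by simp [Matrix.one_apply]
  refine ⟨?_, ?_, ?_, ?_⟩
  · simp [h.card_eq]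
    ring
  · ext (_ | g | g) (_ | k | k) <;>
      simp only [Matrix.add_apply, Matrix.transpose_apply, Matrix.sub_apply, Matrix.smul_apply,
        allOnes_apply, smul_eq_mul, o11, o22, d00, d01, d02, d10, d20, d11, d12, d21, d22,
        Matrix.neg_apply, Matrix.one_apply_eq, Matrix.one_apply_ne, ne_eq, reduceCtorEq,
        Option.some.injEq, not_false_eq_true]
    · ring
    · ring
    · ring
    · ring
    · linear_combination -hP g k + (2 * lam + 1) * hsymm k g
    · linear_combination -hQ g k - hsymm k g
    · ring
    · linear_combination -hQ g k
    · linear_combination -hP g k + (2 * lam + 1) * hsymm k g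
  · ext (_ | g | g) (_ | k | k) <;>
      simp only [Matrix.mul_apply, Matrix.transpose_apply, Fintype.sum_option,
        Fintype.sum_sum_type, d00, d01, d02, d10, d20, d11, d12, d21, d22]
    · simp [hcard]
      ring
    · simp only [neg_one_mul, Finset.sum_neg_distrib, hk]
      simp
    · simp only [neg_one_mul, Finset.sum_neg_distrib, hQ0]
      simp
      ring
    · simp only [mul_neg_one, Finset.sum_neg_distrib, hk]
      simp
    · rw [zero_mul, zero_add, e1]
      simp [o11]
    · rw [zero_mul, zero_add, e3]
      simp
    · simp only [mul_neg_one, Finset.sum_neg_distrib, hQ0]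
      simp
      ring
    · rw [mul_zero, zero_add, e3']
      simp
    · rw [neg_one_mul, neg_neg, ← add_assoc, e2]
      simp [o22]
  · ext (_ | g | g) (_ | k | k) <;>
      simp only [Matrix.mul_apply, Fintype.sum_option, Fintype.sum_sum_type, allOnes_apply, one_mul,
        d00, d01, d02, d10, d20, d11, d12, d21, d22, hk, hk', hQ0, hQ1, Matrix.zero_apply] <;>
      simp [hcard]

end IsSkewPair

end SzekeresMatrix

/-! ### The rank of the Szekeres matrix in characteristic dividing `4 lam + 3` -/

section SzekeresRank

open Matrix

theorem exists_isIdempotentElem_pow {M : Type*} [Monoid M] [Finite M] (x : M) :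
    ∃ m, IsIdempotentElem (x ^ (m + 1)) := by
  obtain ⟨i, j, hij, h⟩ : ∃ i j, i < j ∧ x ^ i = x ^ j := by
    obtain ⟨i, j, hne, h⟩ := Finite.exists_ne_map_eq_of_infinite fun n : ℕ => x ^ n
    rcases lt_or_gt_of_ne hne with hlt | hlt
    · exact ⟨i, j, hlt, h⟩
    · exact ⟨j, i, hlt, h.symm⟩
  obtain ⟨d, rfl⟩ := Nat.exists_eq_add_of_lt hij
  -- The powers of `x` are periodic with period `d + 1` from the exponent `i` on.
  have hper (s t : ℕ) : x ^ (i + t + (d + 1) * s) = x ^ (i + t) := by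
    induction s with
    | zero => simp
    | succ s ih =>
      calc x ^ (i + t + (d + 1) * (s + 1)) = x ^ (i + d + 1) * x ^ (t + (d + 1) * s) := by
            rw [← pow_add]; congr 1; ring
        _ = x ^ (i + t + (d + 1) * s) := by rw [← h, ← pow_add]; congr 1; ring
        _ = x ^ (i + t) := ih
  refine ⟨d * (i + 1) + i, ?_⟩
  have h1 := hper (i + 1) (d * (i + 1) + 1)
  rw [IsIdempotentElem, ← pow_add]
  convert h1 using 2 <;> ring

namespace IsSkewPair

variable {G : Type*} [Fintype G] [DecidableEq G] {F : Type*} [Field F] [Finite F] {lam : ℕ}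
  {P Q : Matrix G G F} (h : IsSkewPair lam P Q)

include h

/-- Let `e` be an idempotent power of `1 + Q`; its column sums are `1`. On the vectors
`(t, e u, (1 - e) u)`, which form a space of dimension `1 + |G|`, the matrix is injective. Indeed the
coordinate at `v₀` of the image is `(2 lam + 1) t`, and since `P` and `Q` commute with `e`, the
component of the last block in the image of `e` is `-(1 + Q) e u`, where `1 + Q` is invertible. Once
`t` and `e u` vanish, the remaining block reads `Q u = 0`, whence `e u = u`. -/
theorem le_rank (h0 : (4 * lam + 3 : F) = 0) : 2 * lam + 2 ≤ (szekeresMatrix lam P Q).rank := by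
  obtain ⟨m, hm⟩ := exists_isIdempotentElem_pow (1 + Q)
  set e := (1 + Q) ^ (m + 1) with he
  have hl : (lam + 1 : F) ≠ 0 := fun hl =>
    one_ne_zero (α := F) (by linear_combination 4 * hl - h0)
  have hk : (2 * lam + 1 : F) ≠ 0 := fun hk =>
    one_ne_zero (α := F) (by linear_combination h0 - 2 * hk)
  have hQ1 : Commute Q (1 + Q) := (Commute.one_right Q).add_right (Commute.refl Q)
  have hQe : Q * e = e * Q := hQ1.pow_right (m + 1)
  have hPtQ : Commute Pᵀ Q := by
    rw [eq_sub_of_add_eq' h.add_transpose_left]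
    refine (Commute.sub_left ?_ (Commute.one_left Q)).sub_left h.mul_comm
    rw [commute_iff_eq, h.allOnes_mul_right, h.mul_allOnes_right]
  have hPte : Pᵀ * e = e * Pᵀ :=
    ((Commute.one_right Pᵀ).add_right hPtQ).pow_right (m + 1)
  have hee : e * e = e := hm
  -- The column sums of `e` are an idempotent power of the unit `lam + 1`, hence `1`.
  have hpow (n : ℕ) : allOnes G F * (1 + Q) ^ n = ((lam + 1 : F) ^ n) • allOnes G F := by
    induction n with
    | zero => simp
    | succ n ih =>
      rw [pow_succ', ← mul_assoc, mul_add, mul_one, h.allOnes_mul_right, add_mul, smul_mul_assoc,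
        ih]
      module
  have hG : Nonempty G := Fintype.card_pos_iff.1 (by rw [h.card_eq]; omega)
  have hone : (lam + 1 : F) ^ (m + 1) = 1 := by
    have h1 : allOnes G F * e * e = allOnes G F * e := by rw [mul_assoc, hee]
    rw [hpow (m + 1), smul_mul_assoc, hpow (m + 1)] at h1
    have h2 := congrFun (congrFun h1 hG.some) hG.some
    simp only [Matrix.smul_apply, allOnes_apply, smul_eq_mul, mul_one] at h2
    exact mul_left_cancel₀ (pow_ne_zero (m + 1) hl) (by rw [h2, mul_one])
  have hJe : allOnes G F * e = allOnes G F := by rw [hpow (m + 1), hone, one_smul]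
  let f : (F × (G → F)) →ₗ[F] (SzekeresVertex G → F) :=
    { toFun := fun y v => match v with
        | none => y.1
        | some (Sum.inl g) => (e *ᵥ y.2) g
        | some (Sum.inr g) => ((1 - e) *ᵥ y.2) g
      map_add' := by
        intro y z
        ext (_ | g | g) <;> simp [Matrix.mulVec_add]
      map_smul' := by
        intro c y
        ext (_ | g | g) <;> simp [Matrix.mulVec_smul] }
  have hinj : Function.Injective ((szekeresMatrix lam P Q).mulVecLin ∘ₗ f) := by
    rw [injective_iff_map_eq_zero]
    rintro ⟨t, u⟩ hy
    have hsum : ∑ g, ((1 - e) *ᵥ u) g = 0 := by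
      rw [← allOnes_mulVec ((1 - e) *ᵥ u) hG.some, Matrix.mulVec_mulVec, mul_sub, mul_one, hJe,
        sub_self, Matrix.zero_mulVec, Pi.zero_apply]
    have ht : t = 0 := by
      have h1 : (2 * lam + 1 : F) * t + (∑ g, (0 : F) * (e *ᵥ u) g +
          ∑ g, (-1) * ((1 - e) *ᵥ u) g) = 0 := by
        have := congrFun hy none
        simpa [Matrix.mulVec, dotProduct, Fintype.sum_option, Fintype.sum_sum_type,
          szekeresMatrix, f] using this
      rw [← Finset.mul_sum, ← Finset.mul_sum, hsum, zero_mul, mul_zero, add_zero, add_zero] at h1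
      exact (mul_eq_zero.1 h1).resolve_left hk
    have ha : ((2 * lam + 1 : F) • 1 - P) *ᵥ (e *ᵥ u) + (-Q) *ᵥ ((1 - e) *ᵥ u) = 0 := by
      ext g
      have h1 : (-1) * t + ((((2 * lam + 1 : F) • 1 - P) *ᵥ (e *ᵥ u)) g +
          ((-Q) *ᵥ ((1 - e) *ᵥ u)) g) = 0 := by
        have := congrFun hy (some (Sum.inl g))
        rw [LinearMap.comp_apply, Matrix.mulVecLin_apply, Matrix.mulVec, dotProduct,
          Fintype.sum_option, Fintype.sum_sum_type] at this
        exact this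
      rwa [ht, mul_zero, zero_add] at h1
    have hb : (-(Q + 1)) *ᵥ (e *ᵥ u) + ((2 * lam + 1 : F) • 1 - Pᵀ) *ᵥ ((1 - e) *ᵥ u) = 0 := by
      ext g
      have h1 : 0 * t + (((-(Q + 1)) *ᵥ (e *ᵥ u)) g +
          (((2 * lam + 1 : F) • 1 - Pᵀ) *ᵥ ((1 - e) *ᵥ u)) g) = 0 := by
        have := congrFun hy (some (Sum.inr g))
        rw [LinearMap.comp_apply, Matrix.mulVecLin_apply, Matrix.mulVec, dotProduct,
          Fintype.sum_option, Fintype.sum_sum_type] at this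
        exact this
      rwa [zero_mul, zero_add] at h1
    -- On the image of `e`, where `1 + Q` is invertible, the second row of blocks gives `e u = 0`.
    have heu : e *ᵥ u = 0 := by
      have h1 := congrArg (fun x => e *ᵥ x) hb
      have h2 : e * (-(Q + 1) * e + ((2 * lam + 1 : F) • 1 - Pᵀ) * (1 - e)) = -(e * (1 + Q)) := by
        have h3 : e * (((2 * lam + 1 : F) • 1 - Pᵀ) * (1 - e)) = 0 := by
          rw [sub_mul, mul_sub e, mul_sub Pᵀ, hPte]
          simp [mul_sub, ← mul_assoc, hee]
        rw [mul_add, h3, add_zero, neg_mul, add_mul, hQe, one_mul, mul_neg, mul_add, mul_add,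
          ← mul_assoc, hee, mul_one, add_comm]
      simp only [Matrix.mulVec_mulVec, ← Matrix.add_mulVec, Matrix.mulVec_zero] at h1
      rw [h2, Matrix.neg_mulVec, neg_eq_zero] at h1
      have h3 := congrArg (fun x => (1 + Q) ^ m *ᵥ x) h1
      have h4 : (1 + Q) ^ m * (e * (1 + Q)) = e := by
        calc (1 + Q) ^ m * (e * (1 + Q)) = (1 + Q) ^ (m + (m + 1) + 1) := by
              rw [he, pow_succ (1 + Q) (m + (m + 1)), pow_add (1 + Q) m (m + 1), mul_assoc]
          _ = e * e := by rw [he, ← pow_add]; congr 1; ring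
          _ = e := hee
      simpa only [Matrix.mulVec_mulVec, Matrix.mulVec_zero, h4] using h3
    have hQu : Q *ᵥ u = 0 := by
      simpa [heu, Matrix.sub_mulVec, Matrix.neg_mulVec] using ha
    have hu (n : ℕ) : (1 + Q) ^ n *ᵥ u = u := by
      induction n with
      | zero => simp
      | succ n ih => rw [pow_succ, ← Matrix.mulVec_mulVec, Matrix.add_mulVec, Matrix.one_mulVec,
          hQu, add_zero, ih]
    rw [he, hu] at heu
    rw [ht, heu]
    rfl
  have hfin := LinearMap.finrank_range_of_inj hinj
  rw [Module.finrank_prod, Module.finrank_self, Module.finrank_fintype_fun_eq_card,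
    h.card_eq] at hfin
  have hle := Submodule.finrank_mono
    (LinearMap.range_comp_le_range f (szekeresMatrix lam P Q).mulVecLin)
  rw [Matrix.rank]
  omega

end IsSkewPair

end SzekeresRank

/-! ### Indicator matrices of the blocks of a skew difference family -/

section Szekeres

open Matrix

variable {G : Type*} [AddCommGroup G] [DecidableEq G]

/-- The matrix of translation by the elements of `X`: the entry at `(w, g)` is `1` if `w - g ∈ X`
and `0` otherwise. -/
def indicatorCirculant (R : Type*) [CommRing R] (X : Finset G) : Matrix G G R :=
  Matrix.circulant fun g => if g ∈ X then 1 else 0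

theorem indicatorCirculant_apply {R : Type*} [CommRing R] (X : Finset G) (g k : G) :
    indicatorCirculant R X g k = if g - k ∈ X then 1 else 0 := rfl

theorem indicatorCirculant_transpose {R : Type*} [CommRing R] (X : Finset G) :
    (indicatorCirculant R X)ᵀ = indicatorCirculant R (-X) := by
  ext g k
  simp [indicatorCirculant_apply]

variable [Fintype G] {R : Type*} [CommRing R]

theorem indicatorCirculant_mul_comm (X Y : Finset G) :
    indicatorCirculant R X * indicatorCirculant R Y =
      indicatorCirculant R Y * indicatorCirculant R X :=
  Matrix.circulant_mul_comm _ _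

theorem indicatorCirculant_mul_allOnes (X : Finset G) :
    indicatorCirculant R X * allOnes G R = (X.card : R) • allOnes G R := by
  ext g k
  have h : ∑ w, (if g - w ∈ X then (1 : R) else 0) = ∑ w, if w ∈ X then (1 : R) else 0 :=
    (Equiv.subLeft g).sum_comp fun w => if w ∈ X then (1 : R) else 0
  simp [Matrix.mul_apply, indicatorCirculant_apply, h]

theorem allOnes_mul_indicatorCirculant (X : Finset G) :
    allOnes G R * indicatorCirculant R X = (X.card : R) • allOnes G R := by
  have h := congrArg Matrix.transpose (indicatorCirculant_mul_allOnes (R := R) (-X))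
  rwa [Matrix.transpose_mul, indicatorCirculant_transpose, neg_neg, Matrix.transpose_smul,
    allOnes_transpose, Finset.card_neg] at h

theorem indicatorCirculant_mul_transpose_apply (X : Finset G) (g k : G) :
    (indicatorCirculant R X * (indicatorCirculant R X)ᵀ) g k =
      (((X ×ˢ X).filter fun xy => g - k = xy.1 - xy.2).card : R) := by
  have h : ((X ×ˢ X).filter fun xy => g - k = xy.1 - xy.2).card =
      (Finset.univ.filter fun w => g - w ∈ X ∧ k - w ∈ X).card := by
    refine Finset.card_bij' (fun xy _ => g - xy.1) (fun w _ => (g - w, k - w)) ?_ ?_ ?_ ?_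
    · rintro ⟨x, y⟩ hxy
      simp only [Finset.mem_filter, Finset.mem_product] at hxy
      obtain ⟨⟨hx, hy⟩, e⟩ := hxy
      have e' : k - (g - x) = y := by rw [← sub_eq_zero, ← sub_eq_zero.2 e.symm]; abel
      simp [hx, hy, e']
    · intro w hw
      simpa using hw
    · rintro ⟨x, y⟩ hxy
      simp only [Finset.mem_filter, Finset.mem_product] at hxy
      obtain ⟨-, e⟩ := hxy
      have e' : k - (g - x) = y := by rw [← sub_eq_zero, ← sub_eq_zero.2 e.symm]; abel
      simp [e']
    · intro w _
      simp
  rw [h]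
  simp only [Matrix.mul_apply, Matrix.transpose_apply, indicatorCirculant_apply,
    ite_zero_mul_ite_zero, mul_one, Finset.sum_boole]

theorem indicatorCirculant_add_transpose {X : Finset G} (hd : Disjoint X (-X))
    (hu : X ∪ -X = Finset.univ \ {0}) :
    indicatorCirculant R X + (indicatorCirculant R X)ᵀ = allOnes G R - 1 := by
  ext g k
  have hmem := Finset.ext_iff.1 hu (g - k)
  have hdis : g - k ∈ X → g - k ∉ -X := fun h => Finset.disjoint_left.1 hd h
  simp only [Finset.mem_union, Finset.mem_sdiff, Finset.mem_univ, Finset.mem_singleton, true_and,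
    sub_eq_zero] at hmem
  rw [indicatorCirculant_transpose, Matrix.add_apply, Matrix.sub_apply, allOnes_apply,
    indicatorCirculant_apply, indicatorCirculant_apply, Matrix.one_apply]
  by_cases h1 : g - k ∈ X <;> by_cases h2 : g - k ∈ -X <;> by_cases h3 : g = k <;>
    simp_all

namespace IsSkewDifferenceFamily

variable {lam : ℕ} {A B : Finset G}

theorem isSkewPair (hlam : 0 < lam)
    (h : IsSkewDifferenceFamily ![A, B] (2 * lam + 1) lam (lam - 1)) :
    IsSkewPair lam (indicatorCirculant R A) (indicatorCirculant R B) := by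
  have hA : A.card = lam := h.card_block 0
  have hB : B.card = lam := h.card_block 1
  have hcomm (X : Finset G) : (indicatorCirculant R X)ᵀ * indicatorCirculant R X =
      indicatorCirculant R X * (indicatorCirculant R X)ᵀ := by
    rw [indicatorCirculant_transpose, indicatorCirculant_mul_comm]
  refine ⟨h.card_group, indicatorCirculant_add_transpose (h.disjoint_neg 0) (h.union_neg 0),
    indicatorCirculant_add_transpose (h.disjoint_neg 1) (h.union_neg 1), ?_, (hcomm A).symm,
    indicatorCirculant_mul_comm A B, ?_, ?_, ?_, ?_⟩
  · rw [hcomm, hcomm]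
    ext g k
    rw [Matrix.add_apply, indicatorCirculant_mul_transpose_apply,
      indicatorCirculant_mul_transpose_apply, ← Nat.cast_add]
    by_cases hgk : g = k
    · subst hgk
      have hdiag (X : Finset G) :
          ((X ×ˢ X).filter fun xy => g - g = xy.1 - xy.2).card = X.card := by
        rw [← Finset.diag_card X]
        congr 1
        ext ⟨x, y⟩
        simp only [sub_self, Finset.mem_filter, Finset.mem_product, Finset.mem_diag,
          eq_comm (a := (0 : G)), sub_eq_zero]
        constructor
        · rintro ⟨⟨hx, -⟩, rfl⟩; exact ⟨hx, rfl⟩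
        · rintro ⟨hx, rfl⟩; exact ⟨⟨hx, hx⟩, rfl⟩
      rw [hdiag, hdiag, hA, hB]
      simp
    · have hd := h.card_differences (g - k) (sub_ne_zero.2 hgk)
      rw [Fin.sum_univ_two] at hd
      simp only [Matrix.cons_val_zero, Matrix.cons_val_one] at hd
      rw [hd, Nat.cast_sub hlam]
      simp [Matrix.one_apply_ne hgk]
  · rw [allOnes_mul_indicatorCirculant, hA]
  · rw [allOnes_mul_indicatorCirculant, hB]
  · rw [indicatorCirculant_mul_allOnes, hA]
  · rw [indicatorCirculant_mul_allOnes, hB]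

end IsSkewDifferenceFamily

end Szekeres

/-! ### The cokernel of the Laplacian map of a digraph -/

section LaplacianOfDigraph

variable {V : Type*} [Fintype V] [DecidableEq V]

open Classical in
theorem Digraph.laplacianMap_apply (Γ : Digraph V) (x : V →₀ ℤ) (w : V) :
    Γ.laplacianMap x w = ∑ v, ((if v = w then ((Γ.dominated v).card : ℤ) else 0) -
      if Γ.Adj v w then 1 else 0) * x v := by
  rw [Digraph.laplacianMap, Digraph.adjacencyMap, LinearMap.sub_apply,
    Finsupp.linearCombination_apply, Finsupp.linearCombination_apply,
    Finsupp.sum_fintype _ _ (by simp), Finsupp.sum_fintype _ _ (by simp), Finsupp.sub_apply,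
    Finsupp.finsetSum_apply, Finsupp.finsetSum_apply, ← Finset.sum_sub_distrib]
  refine Finset.sum_congr rfl fun v _ => ?_
  by_cases hv : v = w <;>
    simp [Finsupp.single_apply, Digraph.dominated, sub_mul, mul_comm, hv]

open Classical in
theorem Digraph.laplacianMatrix_apply (Γ : Digraph V) (w v : V) :
    Γ.laplacianMatrix w v = (if v = w then ((Γ.dominated v).card : ℤ) else 0) -
      if Γ.Adj v w then 1 else 0 := by
  rw [Digraph.laplacianMatrix, LinearMap.toMatrix_apply]
  simp only [Finsupp.coe_basisSingleOne, Finsupp.basisSingleOne_repr, LinearEquiv.refl_apply]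
  rw [Digraph.laplacianMap_apply, Finset.sum_eq_single v]
  · simp
  · intro u _ hu
    simp [Finsupp.single_eq_of_ne hu]
  · simp

theorem Digraph.laplacianMap_eq_mulVec (Γ : Digraph V) (x : V →₀ ℤ) :
    (Γ.laplacianMap x : V → ℤ) = Γ.laplacianMatrix.mulVec x := by
  ext w
  rw [Digraph.laplacianMap_apply]
  exact Finset.sum_congr rfl fun v _ => 
    congrArg (· * x v) (Γ.laplacianMatrix_apply w v).symm

/-- For a doubly regular tournament, the torsion of the cokernel of the Laplacian map consists of the
classes of the vectors of coordinate sum zero: such a vector `x` satisfies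
`D Dᵀ x = (lam + 1) (4 lam + 3) x`, and the range of `D` has coordinate sum zero. -/
theorem Digraph.exists_sumZero_hom_criticalGroup (Γ : Digraph V) {lam : ℕ}
    (hD : IsDoublyRegularLaplacian lam Γ.laplacianMatrix) :
    ∃ π : sumZero V →+ Γ.CriticalGroup, Function.Surjective π ∧
      ∀ x, π x = 0 ↔ ∃ u, Γ.laplacianMatrix.mulVec u = x := by
  let q : sumZero V →+ (V →₀ ℤ) ⧸ LinearMap.range Γ.laplacianMap :=
    ((LinearMap.range Γ.laplacianMap).mkQ.toAddMonoidHom.comp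
      (Finsupp.linearEquivFunOnFinite ℤ ℤ V).symm.toLinearMap.toAddMonoidHom).comp
      (sumZero V).subtype
  have hq (x : V →₀ ℤ) : (LinearMap.range Γ.laplacianMap).mkQ x = 0 ↔
      ∃ u, Γ.laplacianMatrix.mulVec u = x := by
    refine (Submodule.Quotient.mk_eq_zero _).trans ?_
    constructor
    · rintro ⟨u, rfl⟩
      exact ⟨u, (Γ.laplacianMap_eq_mulVec u).symm⟩
    · rintro ⟨u, hu⟩
      refine ⟨(Finsupp.linearEquivFunOnFinite ℤ ℤ V).symm u, ?_⟩
      apply DFunLike.coe_injective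
      rw [Γ.laplacianMap_eq_mulVec, ← hu]
      rfl
  have hq0 (x : sumZero V) : q x = 0 ↔ ∃ u, Γ.laplacianMatrix.mulVec u = x := by
    refine (hq _).trans ?_
    rfl
  have htor (x : sumZero V) : q x ∈ Submodule.torsion ℤ
      ((V →₀ ℤ) ⧸ LinearMap.range Γ.laplacianMap) := by
    rw [Submodule.mem_torsion_iff]
    refine ⟨⟨(lam + 1) * (4 * lam + 3), mem_nonZeroDivisors_of_ne_zero (by positivity)⟩, ?_⟩
    change ((lam + 1) * (4 * lam + 3) : ℤ) • q x = 0
    rw [← map_zsmul, hq0]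
    refine ⟨Γ.laplacianMatrix.transpose.mulVec x, ?_⟩
    rw [hD.mulVec_transpose_mulVec (mem_sumZero.1 x.2)]
    rfl
  refine ⟨q.codRestrict (Submodule.torsion ℤ _).toAddSubgroup htor, ?_, ?_⟩
  · rintro ⟨y, hy⟩
    obtain ⟨x, rfl⟩ := Submodule.mkQ_surjective _ y
    obtain ⟨⟨c, hc⟩, hcx⟩ := (Submodule.mem_torsion_iff _).1 hy
    have hcx' : (LinearMap.range Γ.laplacianMap).mkQ (c • x) = 0 := by
      rw [map_smul]; exact hcx
    obtain ⟨u, hu⟩ := (hq _).1 hcx'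
    have hsum : (x : V → ℤ) ∈ sumZero V := by
      have h1 := hD.sum_mulVec u
      rw [hu] at h1
      simp only [Finsupp.coe_smul, Pi.smul_apply, smul_eq_mul, ← Finset.mul_sum] at h1
      exact (mul_eq_zero.1 h1).resolve_left (nonZeroDivisors.ne_zero hc)
    refine ⟨⟨x, hsum⟩, Subtype.ext ?_⟩
    change (LinearMap.range Γ.laplacianMap).mkQ
      ((Finsupp.linearEquivFunOnFinite ℤ ℤ V).symm x) = _
    congr 1
    ext
    rfl
  · intro x
    rw [← hq0, ← Subtype.coe_inj]
    rfl

end LaplacianOfDigraph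

/-! ### The Laplacian of the Szekeres tournament -/

section SzekeresLaplacian

variable {G : Type*} [AddCommGroup G] [Fintype G] [DecidableEq G] {lam : ℕ} {A B : Finset G}

theorem card_filter_eq_of_iff_sub_mem (g : G) (X : Finset G) {r : G → Prop} [DecidablePred r]
    (hr : ∀ w, r w ↔ w - g ∈ X) : (Finset.univ.filter r).card = X.card := by
  refine Finset.card_bij' (fun w _ => w - g) (fun x _ => x + g) ?_ ?_ ?_ ?_ <;> simp [hr]

theorem IsSkewDifferenceFamily.zero_notMem
    (h : IsSkewDifferenceFamily ![A, B] (2 * lam + 1) lam (lam - 1)) : (0 : G) ∉ B := by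
  intro h0
  have h1 : (0 : G) ∈ B ∪ -B := Finset.mem_union_left _ h0
  rw [show B ∪ -B = Finset.univ \ {0} from h.union_neg 1] at h1
  simp at h1

open Classical in
theorem card_dominated_szekeresTournament
    (h : IsSkewDifferenceFamily ![A, B] (2 * lam + 1) lam (lam - 1)) (v : SzekeresVertex G) :
    (((szekeresTournament A B).dominated v).card : ℤ) = 2 * lam + 1 := by
  have hA : A.card = lam := h.card_block 0
  have hB : B.card = lam := h.card_block 1
  have hB0 := h.zero_notMem
  have hB1 : (B ∪ {0}).card = lam + 1 := by
    rw [Finset.card_union_of_disjoint (by simpa using hB0), hB, Finset.card_singleton]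
  have key : (((szekeresTournament A B).dominated v).card : ℤ) =
      (if (szekeresTournament A B).Adj v none then 1 else 0) +
      ((Finset.univ.filter fun w => (szekeresTournament A B).Adj v (some (Sum.inl w))).card +
       (Finset.univ.filter fun w => (szekeresTournament A B).Adj v (some (Sum.inr w))).card) := by
    rw [Digraph.dominated, Finset.card_filter]
    push_cast
    rw [Fintype.sum_option, Fintype.sum_sum_type, Finset.sum_boole, Finset.sum_boole]
  rw [key]
  rcases v with _ | g | g
  · simp [szekeresTournament, h.card_group]
  · rw [card_filter_eq_of_iff_sub_mem g A (r := fun w => (szekeresTournament A B).Adj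
        (some (Sum.inl g)) (some (Sum.inl w))) fun w => Iff.rfl,
      card_filter_eq_of_iff_sub_mem g (B ∪ {0}) (r := fun w => (szekeresTournament A B).Adj
        (some (Sum.inl g)) (some (Sum.inr w))) fun w => Iff.rfl, hA, hB1]
    simp [szekeresTournament]
    ring
  · rw [card_filter_eq_of_iff_sub_mem g B (r := fun w => (szekeresTournament A B).Adj
        (some (Sum.inr g)) (some (Sum.inl w))) fun w => Iff.rfl,
      card_filter_eq_of_iff_sub_mem g (-A) (r := fun w => (szekeresTournament A B).Adj
        (some (Sum.inr g)) (some (Sum.inr w))) fun w => Iff.rfl, Finset.card_neg, hA, hB]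
    simp [szekeresTournament]
    ring

theorem laplacianMatrix_szekeresTournament
    (h : IsSkewDifferenceFamily ![A, B] (2 * lam + 1) lam (lam - 1)) :
    (szekeresTournament A B).laplacianMatrix =
      szekeresMatrix lam (indicatorCirculant ℤ A) (indicatorCirculant ℤ B) := by
  have hB0 := h.zero_notMem
  ext w v
  rw [Digraph.laplacianMatrix_apply, card_dominated_szekeresTournament h]
  rcases w with _ | w | w <;> rcases v with _ | v | v <;>
    simp only [szekeresMatrix, Matrix.of_apply, Matrix.sub_apply,
      Matrix.smul_apply, Matrix.one_apply, smul_eq_mul] <;>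
    simp [szekeresTournament, indicatorCirculant_apply, Matrix.one_apply, eq_comm]
  -- The block with entries `-(Q + 1)`, where `0 ∉ B` makes the union with `{0}` disjoint.
  by_cases hwv : w = v
  · simp [hwv, hB0]
  · simp [hwv, sub_eq_zero]

omit [Fintype G] in
theorem szekeresMatrix_indicatorCirculant_map (A B : Finset G) (R : Type*) [CommRing R] :
    (szekeresMatrix lam (indicatorCirculant ℤ A) (indicatorCirculant ℤ B)).map (Int.cast : ℤ → R) =
      szekeresMatrix lam (indicatorCirculant R A) (indicatorCirculant R B) := by
  ext (_ | w | w) (_ | v | v) <;>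
    simp only [szekeresMatrix, Matrix.map_apply, Matrix.of_apply, Matrix.sub_apply,
      Matrix.smul_apply, Matrix.one_apply, smul_eq_mul] <;>
    simp [indicatorCirculant_apply, Matrix.one_apply]

end SzekeresLaplacian

theorem theorem2p2 {G : Type*} [AddCommGroup G] [Fintype G] [DecidableEq G]
    (lam : ℕ) (hlam : 0 < lam) (A B : Finset G)
    (hAB : IsSkewDifferenceFamily ![A, B] (2 * lam + 1) lam (lam - 1)) :
    Nonempty ((szekeresTournament A B).CriticalGroup ≃+
      ((Fin (2 * lam + 1) → ZMod (lam + 1)) × (Fin (2 * lam) → ZMod (4 * lam + 3)))) ∧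
    (∀ p : ℕ, p.Prime → p ∣ lam + 1 →
      (szekeresTournament A B).laplacianMatrix.primeRank p = 2 * lam + 1) ∧
    (∀ p : ℕ, p.Prime → p ∣ 4 * lam + 3 →
      (szekeresTournament A B).laplacianMatrix.primeRank p = 2 * lam + 2) := by
  have hL := laplacianMatrix_szekeresTournament hAB
  have hD : IsDoublyRegularLaplacian lam (szekeresTournament A B).laplacianMatrix := by
    rw [hL]
    exact (hAB.isSkewPair hlam).isDoublyRegularLaplacian
  have hr : ∀ p : ℕ, p.Prime → p ∣ 4 * lam + 3 → 2 * lam + 2 ≤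
      ((szekeresTournament A B).laplacianMatrix.map (Int.cast : ℤ → ZMod p)).rank := by
    intro p hp hpn
    have := Fact.mk hp
    have h0 : (4 * lam + 3 : ZMod p) = 0 := by
      have : ((4 * lam + 3 : ℕ) : ZMod p) = 0 := (ZMod.natCast_eq_zero_iff _ _).2 hpn
      exact_mod_cast this
    rw [hL, szekeresMatrix_indicatorCirculant_map]
    exact (hAB.isSkewPair hlam).le_rank h0
  obtain ⟨π, hsurj, hker⟩ := (szekeresTournament A B).exists_sumZero_hom_criticalGroup hD
  exact ⟨hD.nonempty_addEquiv hker hsurj hr, fun p hp hpn => hD.primeRank_of_dvd_succ hp hpn,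
    fun p hp hpn => hD.primeRank_of_dvd hp hpn (hr p hp hpn)⟩
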